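/- For a scheme $X$ of finite type over $\mathbb{Z}$, write $[X]$ for the function $q\mapsto \#X(\mathbb{F}_q)$ on the set of all prime powers; $[X]\in\mathbb{Z}[q]$ means that there is a single polynomial $P\in\mathbb{Z}[q]$ with $\#X(\mathbb{F}_q)=P(q)$ for every prime power $q$. For a finite simple graph $G$ with vertex set $V=\{v_1,\dots,v_n\}$ and edge set $E$: - let $Q_G=\sum_T\prod_{e\in T}x_e\in\mathbb{Z}[x_e : e\in E]$, where $T$ runs over the spanning trees of $G$, and let $X_G=\mathbb{A}^E\setminus V(Q_G)$ be the complement in $\mathbb{A}^E_{\mathbb{Z}}$ of the hypersurface $Q_G=0$; - let $Z^o_G$ be the scheme over $\mathbb{Z}$ of nondegenerate (that is, of invertible determinant) symmetric $n\times n$ matrices $M$ such that $M_{ij}=0$ whenever $i\neq j$ and there is no edge between $v_i$ and $v_j$ in $G$. Let $F$ be a forest (a graph without cycles) with $r$ vertices that is a subgraph of the complete graph $K_s$ on $s$ vertices, and let $G=K_s-F$ be the graph obtained from $K_s$ by removing the edges of $F$ and keeping all $s$ vertices. Then 1. $[Z^o_G]\in\mathbb{Z}[q]$; 2. if $s>r$,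 then $[X_G]\in\mathbb{Z}[q]$. -/

import Mathlib

open CategoryTheory AlgebraicGeometry

noncomputable section

/-- `X` is polynomially countable: there is a single polynomial `P` over `ℤ` such that, for every
finite field `F` with `q` elements (of any characteristic), the set `X(F)` of morphisms
`Spec F ⟶ X` is finite with exactly `P(q)` elements. -/
def PolynomiallyCountable (X : Scheme.{0}) : Prop :=
  ∃ P : Polynomial ℤ, ∀ (F : Type) [Field F] [Finite F],
    Finite (Spec (CommRingCat.of F) ⟶ X) ∧
      (Nat.card (Spec (CommRingCat.of F) ⟶ X) : ℤ) = P.eval (Nat.card F : ℤ)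

open Classical in
/-- `Q_G`, the sum over the spanning trees `T` of `G` of the product of the variables `x_e`
over the edges `e` of `T`. A spanning tree is a tree on the whole vertex set `V` all of whose
edges are edges of `G`. -/
def stanleyPolynomial {V : Type} [Fintype V] (G : SimpleGraph V) : MvPolynomial G.edgeSet ℤ :=
  ∑ T : SimpleGraph V with T ≤ G ∧ T.IsTree,
    ∏ e ∈ Finset.univ.filter (fun e : G.edgeSet => (e : Sym2 V) ∈ T.edgeSet), MvPolynomial.X e

/-- `X_G`, the complement of the hypersurface `Q_G = 0` in the affine space `𝔸^E` over `ℤ`: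
the spectrum of `ℤ[x_e : e ∈ E]` with `Q_G` inverted. -/
def stanleyScheme {V : Type} [Fintype V] (G : SimpleGraph V) : Scheme.{0} :=
  Spec (CommRingCat.of (Localization.Away (stanleyPolynomial G)))

/-- The ideal of `ℤ[y_ij : i, j ∈ V]` generated by all `y_ij - y_ji`, and by all `y_ij` with
`i ≠ j` and `i`, `j` not adjacent in `G`. -/
def symmetricSupportIdeal {V : Type} (G : SimpleGraph V) : Ideal (MvPolynomial (V × V) ℤ) :=
  Ideal.span
    ({p | ∃ i j : V, p = MvPolynomial.X (i, j) - MvPolynomial.X (j, i)} ∪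
      {p | ∃ i j : V, i ≠ j ∧ ¬ G.Adj i j ∧ p = MvPolynomial.X (i, j)})

/-- The generic symmetric matrix whose off-diagonal entries vanish at the non-edges of `G`. -/
def genericSymmetricMatrix {V : Type} (G : SimpleGraph V) :
    Matrix V V (MvPolynomial (V × V) ℤ ⧸ symmetricSupportIdeal G) :=
  Matrix.of fun i j => Ideal.Quotient.mk (symmetricSupportIdeal G) (MvPolynomial.X (i, j))

/-- `Z^o_G`, the scheme over `ℤ` of nondegenerate symmetric `V × V` matrices `M` such that
`M i j = 0` whenever `i ≠ j` and `i`, `j` are not adjacent in `G`. -/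
def nondegSymmetricScheme {V : Type} [Fintype V] [DecidableEq V] (G : SimpleGraph V) :
    Scheme.{0} :=
  Spec (CommRingCat.of (Localization.Away (genericSymmetricMatrix G).det))

end

/-!
Bordering a symmetric matrix `M` of rank `σ` by a row and column `x` and a corner entry `c` gives a
matrix of rank `σ + 2` if `x` lies outside the column space of `M`; otherwise the rank stays `σ` for
exactly one `c` and is `σ + 1` for all the others. Hence the symmetric matrices vanishing at the
edges of a forest `H` can be counted by rank by removing one vertex at a time. At an isolated vertex
all borders are allowed. At a leaf with neighbour `w` the allowed borders form the hyperplane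
`x w = 0`, which contains the column space of `M` exactly if the row `w` of `M` vanishes, in which
case `M` amounts to a matrix for `H` without the leaf and `w`. By induction all the counts are
polynomials in `q`, and `Z^o_G` is the count of full rank for the complement `H` of `G`.

For `X_G`, let `r` be a vertex joined to all the others. By the matrix-tree theorem, `Q_G` is the
determinant of the Laplacian of `G` with weights `x_e`, without the row and column of `r`. The
weights of the edges avoiding `r` are its off-diagonal entries up to sign, and those of the edges at
`r` are its row sums, so it runs through all symmetric matrices on `V \ {r}` vanishing at the
non-edges of `G`. This reduces `X_G` to the previous count for the forest `H` without `r`.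
-/

section BorderedMatrix

variable {W K : Type*}

/-- The matrix `M` bordered by the row `x`, the column `x` and the corner entry `c`, the new index
being `none`. -/
def borderMatrix (M : Matrix W W K) (x : W → K) (c : K) : Matrix (Option W) (Option W) K :=
  Matrix.of fun i j => i.elim (j.elim c x) fun i' => j.elim (x i') (M i')

theorem borderMatrix_isSymm_iff {M : Matrix W W K} {x : W → K} {c : K} :
    (borderMatrix M x c).IsSymm ↔ M.IsSymm := by
  simp only [Matrix.IsSymm.ext_iff, Option.forall, borderMatrix, Matrix.of_apply, Option.elim,
    implies_true, true_and]

theorem borderMatrix_of_isSymm {N : Matrix (Option W) (Option W) K} (hN : N.IsSymm) :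
    borderMatrix (N.submatrix some some) (fun j => N none (some j)) (N none none) = N := by
  ext i j
  rcases i with _ | i <;> rcases j with _ | j
  · rfl
  · rfl
  · exact hN.apply _ _
  · rfl

variable [Fintype W]

theorem borderMatrix_col_mem_range_iff [CommSemiring K] {M : Matrix W W K} {x : W → K}
    {c : K} :
    (borderMatrix M x c).col none ∈
        LinearMap.range ((borderMatrix M x c).submatrix id some).mulVecLin ↔
      ∃ y, M.mulVec y = x ∧ x ⬝ᵥ y = c := by
  refine exists_congr fun y => ?_
  rw [funext_iff, Option.forall, and_comm, funext_iff]
  rfl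

theorem mulVec_dotProduct_comm_of_isSymm [CommSemiring K] {M : Matrix W W K} (hM : M.IsSymm)
    (y z : W → K) :
    M.mulVec y ⬝ᵥ z = M.mulVec z ⬝ᵥ y := by
  rw [dotProduct_comm, Matrix.dotProduct_mulVec, ← Matrix.mulVec_transpose, hM.eq]

theorem range_mulVecLin_option [CommSemiring K] {m : Type*} (A : Matrix m (Option W) K) :
    LinearMap.range A.mulVecLin =
      LinearMap.range (A.submatrix id some).mulVecLin ⊔ K ∙ A.col none := by
  have hcols : Set.range A.col = insert (A.col none) (Set.range (A.submatrix id some).col) := by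
    ext v
    simp only [Set.mem_range, Option.exists, Set.mem_insert_iff, eq_comm (a := v)]
    rfl
  rw [Matrix.range_mulVecLin, Matrix.range_mulVecLin, hcols, Submodule.span_insert, sup_comm]

variable [Field K]

theorem rank_of_col_mem {m : Type*} {A : Matrix m (Option W) K}
    (h : A.col none ∈ LinearMap.range (A.submatrix id some).mulVecLin) :
    A.rank = (A.submatrix id some).rank := by
  rw [Matrix.rank, range_mulVecLin_option, Matrix.rank,
    sup_eq_left.mpr ((Submodule.span_singleton_le_iff_mem _ _).mpr h)]

theorem rank_of_col_notMem {m : Type*} [Finite m] {A : Matrix m (Option W) K}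
    (h : A.col none ∉ LinearMap.range (A.submatrix id some).mulVecLin) :
    A.rank = (A.submatrix id some).rank + 1 := by
  rw [Matrix.rank, range_mulVecLin_option, Submodule.finrank_sup_span_singleton h, Matrix.rank]

variable {M : Matrix W W K}

theorem rank_borderMatrix_submatrix_of_mem (hM : M.IsSymm) {x : W → K} (c : K)
    (hx : x ∈ LinearMap.range M.mulVecLin) :
    ((borderMatrix M x c).submatrix id some).rank = M.rank := by
  let A := ((borderMatrix M x c).submatrix id some).transpose
  have hA : A.submatrix id some = M := hM
  rw [← Matrix.rank_transpose, rank_of_col_mem (A := A) (hA ▸ hx), hA]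

theorem rank_borderMatrix_submatrix_of_notMem (hM : M.IsSymm) {x : W → K} (c : K)
    (hx : x ∉ LinearMap.range M.mulVecLin) :
    ((borderMatrix M x c).submatrix id some).rank = M.rank + 1 := by
  let A := ((borderMatrix M x c).submatrix id some).transpose
  have hA : A.submatrix id some = M := hM
  rw [← Matrix.rank_transpose, rank_of_col_notMem (A := A) (hA ▸ hx), hA]

theorem rank_borderMatrix_mulVec (hM : M.IsSymm) (y : W → K) :
    (borderMatrix M (M.mulVec y) (M.mulVec y ⬝ᵥ y)).rank = M.rank := by
  rw [rank_of_col_mem (borderMatrix_col_mem_range_iff.mpr ⟨y, rfl, rfl⟩),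
    rank_borderMatrix_submatrix_of_mem (x := M.mulVec y) hM _ ⟨y, rfl⟩]

theorem rank_borderMatrix_mulVec_of_ne (hM : M.IsSymm) {y : W → K} {c : K}
    (hc : c ≠ M.mulVec y ⬝ᵥ y) : (borderMatrix M (M.mulVec y) c).rank = M.rank + 1 := by
  rw [rank_of_col_notMem fun h => ?_,
    rank_borderMatrix_submatrix_of_mem (x := M.mulVec y) hM _ ⟨y, rfl⟩]
  obtain ⟨z, hz, rfl⟩ := borderMatrix_col_mem_range_iff.mp h
  exact hc (by rw [mulVec_dotProduct_comm_of_isSymm hM, hz])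

theorem rank_borderMatrix_of_notMem (hM : M.IsSymm) {x : W → K} (c : K)
    (hx : x ∉ LinearMap.range M.mulVecLin) : (borderMatrix M x c).rank = M.rank + 2 := by
  rw [rank_of_col_notMem fun h => ?_, rank_borderMatrix_submatrix_of_notMem hM _ hx]
  obtain ⟨y, hy, -⟩ := borderMatrix_col_mem_range_iff.mp h
  exact hx ⟨y, hy⟩

variable [Fintype K] {R : Type*} [CommRing R] (g : ℕ → R)

theorem sum_rank_borderMatrix_of_mem (hM : M.IsSymm) {x : W → K}
    (hx : x ∈ LinearMap.range M.mulVecLin) :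
    ∑ c, g (borderMatrix M x c).rank = g M.rank + (Fintype.card K - 1) * g (M.rank + 1) := by
  classical
  obtain ⟨y, rfl⟩ := hx
  rw [Fintype.sum_eq_add_sum_compl (M.mulVec y ⬝ᵥ y), Matrix.mulVecLin_apply,
    rank_borderMatrix_mulVec hM]
  have hne : ∀ c ∈ ({M.mulVec y ⬝ᵥ y} : Finset K)ᶜ,
      g (borderMatrix M (M.mulVec y) c).rank = g (M.rank + 1) := fun c hc => by
    rw [rank_borderMatrix_mulVec_of_ne hM (by simpa using hc)]
  rw [Finset.sum_congr rfl hne, Finset.sum_const, Finset.card_compl, Finset.card_singleton,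
    nsmul_eq_mul, Nat.cast_pred Fintype.card_pos]

theorem sum_rank_borderMatrix_of_notMem (hM : M.IsSymm) {x : W → K}
    (hx : x ∉ LinearMap.range M.mulVecLin) :
    ∑ c, g (borderMatrix M x c).rank = Fintype.card K * g (M.rank + 2) := by
  simp [rank_borderMatrix_of_notMem hM _ hx]

/-- The total weight of the matrices obtained by bordering a symmetric matrix of rank `σ` over a
field with `q` elements, where a matrix of rank `ρ` has weight `g ρ` and `u` vectors are allowed as
borders, `a` of which lie in the column space of the matrix. -/
def borderWeight (q u a : R) (g : ℕ → R) (σ : ℕ) : R :=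
  a * (g σ + (q - 1) * g (σ + 1)) + (u - a) * (q * g (σ + 2))

theorem map_borderWeight {S : Type*} [CommRing S] (φ : R →+* S) (q u a : R) (g : ℕ → R) (σ : ℕ) :
    φ (borderWeight q u a g σ) = borderWeight (φ q) (φ u) (φ a) (fun ρ => φ (g ρ)) σ := by
  simp [borderWeight]

open Classical in
theorem sum_sum_rank_borderMatrix (hM : M.IsSymm) (U : Submodule K (W → K)) :
    ∑ x with x ∈ U, ∑ c, g (borderMatrix M x c).rank =
      borderWeight (Fintype.card K : R) (Nat.card U)
        (Nat.card ↥(U ⊓ LinearMap.range M.mulVecLin)) g M.rank := by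
  set S := LinearMap.range M.mulVecLin
  have hS : (Finset.univ.filter fun x => x ∈ U ∧ x ∈ S).card = Nat.card ↥(U ⊓ S) := by
    simp only [← Submodule.mem_inf, Nat.card_eq_fintype_card, Fintype.card_subtype]
  have hU : Nat.card U = Nat.card ↥(U ⊓ S) + (Finset.univ.filter fun x => x ∈ U ∧ x ∉ S).card := by
    rw [← hS, Nat.card_eq_fintype_card, Fintype.card_subtype,
      ← Finset.card_filter_add_card_filter_not (· ∈ S), Finset.filter_filter, Finset.filter_filter]
  rw [← Finset.sum_filter_add_sum_filter_not _ (· ∈ S), Finset.filter_filter, Finset.filter_filter,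
    Finset.sum_congr rfl fun x hx =>
      sum_rank_borderMatrix_of_mem g hM (Finset.mem_filter.mp hx).2.2,
    Finset.sum_congr rfl fun x hx =>
      sum_rank_borderMatrix_of_notMem g hM (Finset.mem_filter.mp hx).2.2,
    Finset.sum_const, Finset.sum_const, nsmul_eq_mul, nsmul_eq_mul, hS, borderWeight, hU,
    Nat.cast_add, add_sub_cancel_left]

end BorderedMatrix

section SymmetricAvoiding

/-- `M` is symmetric and vanishes at the edges of `H`: these are the matrices supported on the
complement of `H` in the informal statement. -/
structure IsSymmAvoiding {V K : Type*} [Zero K] (H : SimpleGraph V) (M : Matrix V V K) : Prop where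
  isSymm : M.IsSymm
  apply_eq_zero ⦃i j : V⦄ : H.Adj i j → M i j = 0

theorem isSymmAvoiding_comap_iff {V W K : Type*} [Zero K] {H : SimpleGraph V} (e : W ≃ V)
    {M : Matrix W W K} :
    IsSymmAvoiding (H.comap e) M ↔ IsSymmAvoiding H (Matrix.reindex e e M) := by
  refine ⟨fun h => ⟨h.isSymm.submatrix _, fun i j hij => h.apply_eq_zero (by simpa using hij)⟩,
    fun h => ⟨?_, fun i j hij => ?_⟩⟩
  · simpa using h.isSymm.submatrix e
  · simpa using h.apply_eq_zero hij

/-- The vectors allowed as borders of a symmetric matrix avoiding `H`: those that vanish at the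
neighbours of `none`. -/
def borderSpace {W : Type*} (H : SimpleGraph (Option W)) (K : Type*) [Semiring K] :
    Submodule K (W → K) where
  carrier := {x | ∀ i, H.Adj none (some i) → x i = 0}
  add_mem' ha hb i hi := by simp [ha i hi, hb i hi]
  zero_mem' _ _ := rfl
  smul_mem' c x hx i hi := by simp [hx i hi]

theorem isSymmAvoiding_borderMatrix_iff {W K : Type*} [Semiring K] {H : SimpleGraph (Option W)}
    {M : Matrix W W K} {x : W → K} {c : K} :
    IsSymmAvoiding H (borderMatrix M x c) ↔
      IsSymmAvoiding (H.comap some) M ∧ x ∈ borderSpace H K := by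
  constructor
  · exact fun h => ⟨⟨borderMatrix_isSymm_iff.mp h.isSymm, fun i j hij => h.apply_eq_zero hij⟩,
      fun i hi => h.apply_eq_zero hi⟩
  · rintro ⟨hM, hx⟩
    refine ⟨borderMatrix_isSymm_iff.mpr hM.isSymm, ?_⟩
    rintro (_ | i) (_ | j) hij
    · exact absurd hij (H.irrefl)
    · exact hx j hij
    · exact hx i hij.symm
    · exact hM.apply_eq_zero hij

theorem finrank_inf_ker_add_one {K E : Type*} [Field K] [AddCommGroup E] [Module K E]
    {S : Submodule K E} [FiniteDimensional K S] {f : Module.Dual K E}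
    (h : ¬ S ≤ LinearMap.ker f) :
    Module.finrank K ↥(S ⊓ LinearMap.ker f) + 1 = Module.finrank K S := by
  have hf : f.domRestrict S ≠ 0 := fun h0 => h fun x hx => LinearMap.congr_fun h0 ⟨x, hx⟩
  rw [← Module.Dual.finrank_ker_add_one_of_ne_zero hf, LinearMap.ker_domRestrict,
    ← Submodule.map_comap_subtype, Submodule.finrank_map_subtype_eq]

theorem natCard_inf_ker {K E : Type*} [Field K] [Fintype K] [AddCommGroup E] [Module K E]
    {S : Submodule K E} [FiniteDimensional K S] {f : Module.Dual K E}
    (h : ¬ S ≤ LinearMap.ker f) :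
    Nat.card ↥(S ⊓ LinearMap.ker f) = Fintype.card K ^ (Module.finrank K S - 1) := by
  rw [Module.natCard_eq_pow_finrank (K := K), ← finrank_inf_ker_add_one h, Nat.add_sub_cancel,
    Nat.card_eq_fintype_card]

theorem range_mulVecLin_le_ker_proj_iff {V K : Type*} [Fintype V] [CommSemiring K]
    {M : Matrix V V K} {i : V} :
    LinearMap.range M.mulVecLin ≤ LinearMap.ker (LinearMap.proj i) ↔ M i = 0 := by
  rw [LinearMap.range_le_ker_iff]
  exact ⟨fun h => dotProduct_eq_zero _ fun v => LinearMap.congr_fun h v,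
    fun h => LinearMap.ext fun v => by simp [Matrix.mulVec, h]⟩

variable {V W : Type*} [Fintype V] [Fintype W] (K : Type*) [Field K] [Fintype K]

/-- The symmetric matrices over `K` that vanish at the edges of `H`. -/
noncomputable def symmAvoidingMatrices (H : SimpleGraph V) : Finset (Matrix V V K) :=
  (Set.toFinite {M | IsSymmAvoiding H M}).toFinset

variable {K} in
theorem mem_symmAvoidingMatrices {H : SimpleGraph V} {M : Matrix V V K} :
    M ∈ symmAvoidingMatrices K H ↔ IsSymmAvoiding H M :=
  Set.Finite.mem_toFinset _

open Classical in
theorem sum_symmAvoidingMatrices_option {A : Type*} [AddCommMonoid A] (H : SimpleGraph (Option W))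
    (f : Matrix (Option W) (Option W) K → A) :
    ∑ N ∈ symmAvoidingMatrices K H, f N =
      ∑ M ∈ symmAvoidingMatrices K (H.comap some), ∑ x with x ∈ borderSpace H K,
        ∑ c, f (borderMatrix M x c) := by
  simp_rw [← Finset.sum_product']
  refine Finset.sum_nbij'
    (fun N => (N.submatrix some some, fun i => N none (some i), N none none))
    (fun p => borderMatrix p.1 p.2.1 p.2.2) (fun N hN => ?_) (fun p hp => ?_) (fun N hN => ?_)
    (fun _ _ => rfl) (fun N hN => ?_)
  all_goals simp only [Finset.mem_product, Finset.mem_filter_univ, Finset.mem_univ, and_true,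
    mem_symmAvoidingMatrices] at *
  · rw [← isSymmAvoiding_borderMatrix_iff, borderMatrix_of_isSymm hN.isSymm]
    exact hN
  · exact isSymmAvoiding_borderMatrix_iff.mpr hp
  · exact borderMatrix_of_isSymm hN.isSymm
  · rw [borderMatrix_of_isSymm hN.isSymm]

variable {R : Type*} [CommRing R]

/-- The total weight of the symmetric matrices over `K` that vanish at the edges of `H`, where a
matrix of rank `ρ` has weight `g ρ`. Arbitrary weights make the recursions on `H` linear. -/
noncomputable def rankSum (H : SimpleGraph V) (g : ℕ → R) : R :=
  ∑ M ∈ symmAvoidingMatrices K H, g M.rank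

theorem rankSum_comap (H : SimpleGraph V) (e : W ≃ V) (g : ℕ → R) :
    rankSum K (H.comap e) g = rankSum K H g :=
  Finset.sum_equiv (Matrix.reindex e e)
    (fun M => by simp only [mem_symmAvoidingMatrices, isSymmAvoiding_comap_iff])
    fun M _ => by rw [Matrix.rank_reindex]

theorem rankSum_option (H : SimpleGraph (Option W)) (g : ℕ → R) :
    rankSum K H g = ∑ M ∈ symmAvoidingMatrices K (H.comap some),
      borderWeight (Fintype.card K : R) (Nat.card (borderSpace H K))
        (Nat.card ↥(borderSpace H K ⊓ LinearMap.range M.mulVecLin)) g M.rank := by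
  rw [rankSum, sum_symmAvoidingMatrices_option]
  exact Finset.sum_congr rfl fun M hM =>
    sum_sum_rank_borderMatrix g (mem_symmAvoidingMatrices.mp hM).isSymm _

theorem natCard_range_mulVecLin (M : Matrix V V K) :
    Nat.card (LinearMap.range M.mulVecLin) = Fintype.card K ^ M.rank := by
  rw [Module.natCard_eq_pow_finrank (K := K), Nat.card_eq_fintype_card, Matrix.rank]

theorem rankSum_of_isolated {H : SimpleGraph (Option W)} (hH : ∀ i, ¬ H.Adj none (some i)) {q : R}
    (hq : Fintype.card K = q) (g : ℕ → R) :
    rankSum K H g = rankSum K (H.comap some) fun σ =>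
      borderWeight q (q ^ Fintype.card W) (q ^ σ) g σ := by
  have hU : borderSpace H K = ⊤ := eq_top_iff.mpr fun x _ i hi => absurd hi (hH i)
  rw [rankSum_option, hU, Module.natCard_eq_pow_finrank (K := K), finrank_top,
    Module.finrank_fintype_fun_eq_card, Nat.card_eq_fintype_card, Nat.cast_pow]
  simp only [top_inf_eq, natCard_range_mulVecLin, Nat.cast_pow, hq]
  rfl

theorem sum_symmAvoidingMatrices_row_none_eq_zero [DecidableEq K] (H : SimpleGraph (Option W))
    (f : ℕ → R) :
    ∑ N ∈ symmAvoidingMatrices K H with N none = 0, f N.rank = rankSum K (H.comap some) f := by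
  have hborder {N : Matrix (Option W) (Option W) K} (hN : N.IsSymm) (h0 : N none = 0) :
      borderMatrix (N.submatrix some some) 0 0 = N := by
    have hN' := borderMatrix_of_isSymm hN
    rw [h0] at hN'
    exact hN'
  symm
  refine Finset.sum_nbij' (fun M => borderMatrix M 0 0) (fun N => N.submatrix some some)
    (fun M hM => ?_) (fun N hN => ?_) (fun _ _ => rfl) (fun N hN => ?_) (fun M hM => ?_)
  all_goals simp only [Finset.mem_filter, mem_symmAvoidingMatrices] at *
  · refine ⟨isSymmAvoiding_borderMatrix_iff.mpr ⟨hM, Submodule.zero_mem _⟩, ?_⟩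
    ext (_ | j) <;> rfl
  · exact ⟨hN.1.isSymm.submatrix some, fun i j hij => hN.1.apply_eq_zero hij⟩
  · exact hborder hN.1.isSymm hN.2
  · simpa using congrArg f (rank_borderMatrix_mulVec hM.isSymm 0).symm

theorem rankSum_of_leaf {H : SimpleGraph (Option (Option W))}
    (hH : ∀ i, H.Adj none (some i) ↔ i = none) {q : R} (hq : Fintype.card K = q) (g : ℕ → R) :
    rankSum K H g =
      rankSum K (H.comap some)
        (fun σ => borderWeight q (q ^ Fintype.card W) (q ^ (σ - 1)) g σ) +
      rankSum K ((H.comap some).comap some)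
        (fun σ => borderWeight q (q ^ Fintype.card W) (q ^ σ) g σ -
          borderWeight q (q ^ Fintype.card W) (q ^ (σ - 1)) g σ) := by
  classical
  have hU : borderSpace H K = ⊤ ⊓ LinearMap.ker (LinearMap.proj none) := by
    ext x
    simp [borderSpace, hH]
  have hcardU : Nat.card (borderSpace H K) = Fintype.card K ^ Fintype.card W := by
    have hproj : ¬ ⊤ ≤ LinearMap.ker (LinearMap.proj none : Module.Dual K (Option W → K)) :=
      fun h => one_ne_zero (h (Submodule.mem_top (x := fun _ => 1)))
    rw [hU, natCard_inf_ker hproj, finrank_top, Module.finrank_fintype_fun_eq_card,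
      Fintype.card_option, Nat.add_sub_cancel]
  have hcard (M : Matrix (Option W) (Option W) K) :
      Nat.card ↥(borderSpace H K ⊓ LinearMap.range M.mulVecLin) =
        Fintype.card K ^ if M none = 0 then M.rank else M.rank - 1 := by
    rw [hU, top_inf_eq, inf_comm]
    split_ifs with h0
    · rw [inf_eq_left.mpr (range_mulVecLin_le_ker_proj_iff.mpr h0), natCard_range_mulVecLin]
    · rw [natCard_inf_ker (mt range_mulVecLin_le_ker_proj_iff.mp h0), Matrix.rank]
  rw [rankSum_option, ← sum_symmAvoidingMatrices_row_none_eq_zero K (H.comap some),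
    Finset.sum_filter, rankSum, ← Finset.sum_add_distrib]
  refine Finset.sum_congr rfl fun M _ => ?_
  rw [hcardU, hcard, Nat.cast_pow, Nat.cast_pow, hq]
  split_ifs <;> ring

end SymmetricAvoiding

section Forest

open Polynomial

theorem exists_subsingleton_neighborSet_of_isAcyclic {V : Type*} [Finite V] [Nonempty V]
    {H : SimpleGraph V} (hH : H.IsAcyclic) : ∃ v, (H.neighborSet v).Subsingleton := by
  classical
  have := Fintype.ofFinite V
  by_cases hbot : H = ⊥
  · subst hbot
    exact ⟨Classical.arbitrary V, fun _ ha => absurd ha (by simp)⟩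
  obtain ⟨a, b, hab⟩ := SimpleGraph.ne_bot_iff_exists_adj.mp hbot
  let c := H.connectedComponentMk a
  have hadj {v : c} {u : V} (hu : H.Adj v u) : u ∈ c :=
    (SimpleGraph.ConnectedComponent.sound hu.symm.reachable).trans v.2
  have : Nontrivial c := ⟨⟨a, rfl⟩, ⟨b, hadj (v := ⟨a, rfl⟩) hab⟩, fun h => hab.ne congr($h)⟩
  obtain ⟨v, hv⟩ := (hH.isTree_connectedComponent c).exists_vert_degree_one_of_nontrivial
  obtain ⟨w, -, hw⟩ := SimpleGraph.degree_eq_one_iff_existsUnique_adj.mp hv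
  refine ⟨v, fun x hx y hy => ?_⟩
  exact congrArg Subtype.val ((hw ⟨x, hadj hx⟩ hx).trans (hw ⟨y, hadj hy⟩ hy).symm)

theorem rankSum_of_isEmpty {V K R : Type*} [Fintype V] [IsEmpty V] [Field K] [Fintype K]
    [CommRing R] (H : SimpleGraph V) (g : ℕ → R) : rankSum K H g = g 0 := by
  have h0 : symmAvoidingMatrices K H = {0} := by
    ext M
    simp only [mem_symmAvoidingMatrices, Finset.mem_singleton, Subsingleton.elim M 0, iff_true]
    exact ⟨Matrix.isSymm_zero, fun _ _ _ => rfl⟩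
  rw [rankSum, h0, Finset.sum_singleton, Matrix.rank_zero]

variable {V : Type*} [Fintype V]

/-- For all rank weights that are polynomials in the number `q` of elements of the field, the total
weight of the symmetric matrices vanishing at the edges of `H` is a polynomial in `q`. -/
def IsPolynomialRankSum (H : SimpleGraph V) : Prop :=
  ∀ g : ℕ → ℤ[X], ∃ P : ℤ[X], ∀ (K : Type) [Field K] [Fintype K],
    rankSum K H (fun σ => (g σ).eval (Fintype.card K : ℤ)) = P.eval (Fintype.card K : ℤ)

theorem eval_borderWeight (q : ℤ) (e a : ℕ) (g : ℕ → ℤ[X]) (σ : ℕ) :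
    (borderWeight X (X ^ e) (X ^ a) g σ).eval q =
      borderWeight q (q ^ e) (q ^ a) (fun ρ => (g ρ).eval q) σ := by
  simpa using map_borderWeight (evalRingHom q) X (X ^ e) (X ^ a) g σ

theorem IsPolynomialRankSum.of_comap {W : Type*} [Fintype W] (e : W ≃ V) {H : SimpleGraph V}
    (h : IsPolynomialRankSum (H.comap e)) : IsPolynomialRankSum H := by
  simpa only [IsPolynomialRankSum, rankSum_comap] using h

theorem IsPolynomialRankSum.of_isolated {H : SimpleGraph (Option V)}
    (hH : ∀ i, ¬ H.Adj none (some i)) (h : IsPolynomialRankSum (H.comap some)) :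
    IsPolynomialRankSum H := fun g => by
  obtain ⟨P, hP⟩ := h fun σ => borderWeight X (X ^ Fintype.card V) (X ^ σ) g σ
  refine ⟨P, fun K _ _ => ?_⟩
  rw [rankSum_of_isolated K hH rfl, ← hP K]
  simp only [eval_borderWeight]

theorem IsPolynomialRankSum.of_leaf {H : SimpleGraph (Option (Option V))}
    (hH : ∀ i, H.Adj none (some i) ↔ i = none) (h : IsPolynomialRankSum (H.comap some))
    (h' : IsPolynomialRankSum ((H.comap some).comap some)) : IsPolynomialRankSum H := fun g => by
  obtain ⟨P, hP⟩ := h fun σ => borderWeight X (X ^ Fintype.card V) (X ^ (σ - 1)) g σ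
  obtain ⟨Q, hQ⟩ := h' fun σ => borderWeight X (X ^ Fintype.card V) (X ^ σ) g σ -
    borderWeight X (X ^ Fintype.card V) (X ^ (σ - 1)) g σ
  refine ⟨P + Q, fun K _ _ => ?_⟩
  rw [rankSum_of_leaf K hH rfl, eval_add, ← hP K, ← hQ K]
  simp only [eval_sub, eval_borderWeight]

theorem isPolynomialRankSum_of_isAcyclic {H : SimpleGraph V} (hH : H.IsAcyclic) :
    IsPolynomialRankSum H := by
  classical
  induction hn : Fintype.card V using Nat.strong_induction_on generalizing V with | _ n ih => ?_
  subst hn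
  obtain hV | hV := isEmpty_or_nonempty V
  · exact fun g => ⟨g 0, fun K _ _ => rankSum_of_isEmpty H _⟩
  obtain ⟨v, hv⟩ := exists_subsingleton_neighborSet_of_isAcyclic hH
  have hcomap {W : Type _} [Fintype W] (f : W ↪ V) (hf : ∀ i, f i ≠ v) :
      IsPolynomialRankSum (H.comap f) :=
    ih _ (Fintype.card_lt_of_injective_of_notMem f f.injective (b := v) (by simpa using hf))
      (hH.comap (SimpleGraph.Embedding.comap f H).toHom f.injective) rfl
  obtain hempty | ⟨w, hw⟩ := (H.neighborSet v).eq_empty_or_nonempty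
  · let e : Option {i // i ≠ v} ≃ V := Equiv.optionSubtypeNe v
    exact .of_comap e <| .of_isolated (fun i hi => hempty.subset hi) <|
      hcomap (.trans .some e.toEmbedding) fun i => i.2
  · let w' : {i // i ≠ v} := ⟨w, hw.ne'⟩
    let e : Option (Option {i // i ≠ w'}) ≃ V :=
      (Equiv.optionSubtypeNe w').optionCongr.trans (Equiv.optionSubtypeNe v)
    refine .of_comap e <| .of_leaf (fun i => ⟨fun hi => ?_, ?_⟩)
      (hcomap (.trans .some e.toEmbedding) fun i => ?_)
      (hcomap (.trans .some (.trans .some e.toEmbedding)) fun i => i.1.2)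
    · exact Option.some_injective _ (e.injective (hv hi hw))
    · rintro rfl
      exact hw
    · exact (Equiv.optionSubtypeNe w' i).2

end Forest

section MatrixTree

variable {V : Type*} {r : V}

/-- `f` assigns a parent to every vertex other than `r` in such a way that iterating it leads to
`r`; this is encoded by a height function `d` that decreases from a vertex to its parent. -/
def IsRootedParent (f : {i // i ≠ r} → V) : Prop :=
  ∃ d : V → ℕ, ∀ i, d (f i) < d i

/-- The graph with an edge from each vertex other than the root to its parent. -/
def parentGraph (f : {i // i ≠ r} → V) : SimpleGraph V :=
  SimpleGraph.fromEdgeSet (Set.range fun i => s(i.1, f i))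

section Rooted

variable {f g : {i // i ≠ r} → V}

theorem IsRootedParent.ne (hf : IsRootedParent f) (i : {i // i ≠ r}) : f i ≠ i := fun h => by
  obtain ⟨d, hd⟩ := hf
  exact (hd i).ne congr(d $h)

theorem IsRootedParent.edge_injective (hf : IsRootedParent f) :
    Function.Injective fun i : {i // i ≠ r} => s(i.1, f i) := fun i j hij => by
  obtain ⟨d, hd⟩ := hf
  obtain ⟨h, -⟩ | ⟨hi, hj⟩ := Sym2.eq_iff.mp hij
  · exact Subtype.ext h
  · exact absurd ((hd i).trans (hi ▸ hd j)) (hj ▸ lt_irrefl _)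

theorem IsRootedParent.edgeSet_parentGraph (hf : IsRootedParent f) :
    (parentGraph f).edgeSet = Set.range fun i => s(i.1, f i) := by
  rw [parentGraph, SimpleGraph.edgeSet_fromEdgeSet, sdiff_eq_left, Set.disjoint_left]
  rintro _ ⟨i, rfl⟩ h
  exact hf.ne i (Sym2.mk_isDiag_iff.mp h).symm

theorem IsRootedParent.parentGraph_le_iff (hf : IsRootedParent f) {T : SimpleGraph V} :
    parentGraph f ≤ T ↔ ∀ i : {i // i ≠ r}, T.Adj i (f i) := by
  rw [← SimpleGraph.edgeSet_subset_edgeSet, hf.edgeSet_parentGraph, Set.range_subset_iff]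
  rfl

theorem IsRootedParent.adj_parent (hf : IsRootedParent f) (i : {i // i ≠ r}) :
    (parentGraph f).Adj i (f i) :=
  hf.parentGraph_le_iff.mp le_rfl i

theorem IsRootedParent.connected_parentGraph (hf : IsRootedParent f) :
    (parentGraph f).Connected := by
  have hadj := hf.adj_parent
  obtain ⟨d, hd⟩ := hf
  have hreach (v : V) : (parentGraph f).Reachable v r := by
    induction hv : d v using Nat.strong_induction_on generalizing v with | _ n ih => ?_
    by_cases h : v = r
    · rw [h]
    · exact (hadj ⟨v, h⟩).reachable.trans (ih _ (hv ▸ hd ⟨v, h⟩) _ rfl)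
  have : Nonempty V := ⟨r⟩
  exact ⟨fun u v => (hreach u).trans (hreach v).symm⟩

theorem IsRootedParent.isTree_parentGraph [Finite V] (hf : IsRootedParent f) :
    (parentGraph f).IsTree := by
  classical
  rw [SimpleGraph.isTree_iff_connected_and_card]
  refine ⟨hf.connected_parentGraph, ?_⟩
  rw [hf.edgeSet_parentGraph, Nat.card_range_of_injective hf.edge_injective,
    ← Nat.card_congr (Equiv.optionSubtypeNe r), Finite.card_option]

theorem IsRootedParent.eq_of_parentGraph_eq (hf : IsRootedParent f) (hg : IsRootedParent g)
    (h : parentGraph f = parentGraph g) : f = g := by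
  have hadj := hf.adj_parent
  obtain ⟨d, hd⟩ := hf
  funext i
  induction hi : d i using Nat.strong_induction_on generalizing i with | _ n ih => ?_
  obtain ⟨j, hj⟩ : s(i.1, f i) ∈ Set.range fun i => s(i.1, g i) := by
    rw [← hg.edgeSet_parentGraph, ← h]
    exact hadj i
  obtain ⟨hji, hgf⟩ | ⟨hjf, hgi⟩ := Sym2.eq_iff.mp hj
  · rw [← hgf, Subtype.ext hji]
  · -- Otherwise `j` is the parent of `i` and, by induction, `i` is the parent of `j`.
    have hlt : d j < d i := hjf ▸ hd i
    have hfg : f j = g j := ih _ (hi ▸ hlt) j rfl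
    exact absurd (hd j) (by rw [hfg, hgi]; exact hlt.not_gt)

theorem exists_parentGraph_eq_of_isTree (r : V) {T : SimpleGraph V} (hT : T.IsTree) :
    ∃ f : {i // i ≠ r} → V, IsRootedParent f ∧ parentGraph f = T := by
  have hstep (i : {i // i ≠ r}) : ∃ u, T.Adj i u ∧ T.dist u r < T.dist i r := by
    obtain ⟨p, hp⟩ := hT.connected.exists_walk_length_eq_dist i.1 r
    obtain ⟨u, hu, q, rfl⟩ := p.exists_eq_cons_of_ne i.2
    exact ⟨u, hu, hp ▸ Nat.lt_succ_of_le (SimpleGraph.dist_le q)⟩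
  choose f hadj hdist using hstep
  have hf : IsRootedParent f := ⟨fun v => T.dist v r, hdist⟩
  have hle : parentGraph f ≤ T := hf.parentGraph_le_iff.mpr hadj
  exact ⟨f, hf, hle.antisymm
    ((SimpleGraph.isTree_iff_minimal_connected.mp hT).2 hf.connected_parentGraph hle)⟩

/-- The parent function extended by the root as its own parent, so that it can be iterated. -/
def parentStep [DecidableEq V] (f : {i // i ≠ r} → V) (v : V) : V :=
  if h : v = r then r else f ⟨v, h⟩

theorem parentStep_coe [DecidableEq V] (i : {i // i ≠ r}) : parentStep f i = f i :=
  dif_neg i.2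

theorem isRootedParent_of_forall_exists_iterate [DecidableEq V]
    (h : ∀ v, ∃ k, (parentStep f)^[k] v = r) :
    IsRootedParent f := by
  refine ⟨fun v => Nat.find (h v), fun i => ?_⟩
  change Nat.find (h (f i)) < Nat.find (h i)
  have hfind := Nat.find_spec (h i)
  rcases hk : Nat.find (h i) with _ | k
  · rw [hk] at hfind
    exact absurd hfind i.2
  · rw [hk, Function.iterate_succ_apply, parentStep_coe] at hfind
    exact Nat.lt_succ_of_le (Nat.find_min' (h (f i)) hfind)

end Rooted

theorem det_eq_zero_of_mulVec_eq_zero {n K : Type*} [Fintype n] [DecidableEq n] [CommRing K]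
    {M : Matrix n n K} {x : n → K} (h : M.mulVec x = 0) {i : n} (hi : x i = 1) : M.det = 0 := by
  have hdet : M.det • x = 0 := by
    rw [← Matrix.one_mulVec x, ← Matrix.smul_mulVec, ← Matrix.adjugate_mul, ← Matrix.mulVec_mulVec,
      h, Matrix.mulVec_zero]
  simpa [hi] using congrFun hdet i

section ParentMatrix

variable [DecidableEq V] (K : Type*) [CommRing K] {f : {i // i ≠ r} → V}

/-- The matrix `1 - A`, where `A` is the transition matrix of `f` without the row and the column of
the root: the determinants of these matrices are the coefficients of the reduced Laplacian
determinant. -/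
def parentMatrix (f : {i // i ≠ r} → V) : Matrix {i // i ≠ r} {i // i ≠ r} K :=
  1 - Matrix.of fun i j => if f i = j.1 then 1 else 0

theorem parentMatrix_apply_of_ne {i j : {i // i ≠ r}} (h : f i ≠ j) :
    parentMatrix K f i j = (1 : Matrix {i // i ≠ r} {i // i ≠ r} K) i j := by
  rw [parentMatrix, Matrix.sub_apply, Matrix.of_apply, if_neg h, sub_zero]

variable [Fintype V]

theorem IsRootedParent.det_parentMatrix (hf : IsRootedParent f) : (parentMatrix K f).det = 1 := by
  obtain ⟨d, hd⟩ := hf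
  let height : {i // i ≠ r} → ℕᵒᵈ := fun i => OrderDual.toDual (d i)
  have happly {i j : {i // i ≠ r}} (h : d i ≤ d j) :
      parentMatrix K f i j = (1 : Matrix {i // i ≠ r} {i // i ≠ r} K) i j :=
    parentMatrix_apply_of_ne K fun hij => (hd i).not_ge (hij ▸ h)
  have htriangular : (parentMatrix K f).BlockTriangular height := fun i j hij => by
    have hij' : d i < d j := hij
    have hne : i ≠ j := fun h => hij'.ne congr(d $h)
    rw [happly hij'.le, Matrix.one_apply_ne hne]
  rw [htriangular.det]
  refine Finset.prod_eq_one fun a _ => ?_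
  suffices h : (parentMatrix K f).toSquareBlock height a = 1 by rw [h, Matrix.det_one]
  ext ⟨i, hi⟩ ⟨j, hj⟩
  have hij : d i = d j := hi.trans hj.symm
  simp only [Matrix.toSquareBlock_def, Matrix.of_apply, happly hij.le, Matrix.one_apply,
    Subtype.mk.injEq]

theorem parentMatrix_mulVec {x : V → K} (hx : x r = 0) (i : {i // i ≠ r}) :
    (parentMatrix K f).mulVec (fun j => x j) i = x i - x (f i) := by
  have hsum : ∑ j : {i // i ≠ r}, (if f i = j then x j else 0) = x (f i) := by
    by_cases hfi : f i = r
    · rw [hfi, hx]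
      exact Finset.sum_eq_zero fun j _ => if_neg j.2.symm
    · rw [Finset.sum_eq_single_of_mem ⟨f i, hfi⟩ (Finset.mem_univ _) fun j _ hj =>
        if_neg fun h => hj (Subtype.ext h.symm), if_pos rfl]
  rw [parentMatrix, Matrix.sub_mulVec, Matrix.one_mulVec, Pi.sub_apply]
  simp only [Matrix.mulVec, dotProduct, Matrix.of_apply, ite_mul, one_mul, zero_mul, hsum]

theorem det_parentMatrix_of_not_isRootedParent (hf : ¬ IsRootedParent f) :
    (parentMatrix K f).det = 0 := by
  classical
  obtain ⟨u, hu⟩ : ∃ u, ∀ k, (parentStep f)^[k] u ≠ r := by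
    by_contra! h
    exact hf (isRootedParent_of_forall_exists_iterate h)
  -- The indicator of the vertices from which `f` never leads to the root is in the kernel.
  let x : V → K := fun v => if ∀ k, (parentStep f)^[k] v ≠ r then 1 else 0
  have hx : x r = 0 := if_neg fun h => h 0 rfl
  refine det_eq_zero_of_mulVec_eq_zero (x := fun i => x i) (i := ⟨u, hu 0⟩) ?_ (if_pos hu)
  ext i
  have hstep : (∀ k, (parentStep f)^[k] (f i) ≠ r) ↔ ∀ k, (parentStep f)^[k] i ≠ r := by
    rw [← parentStep_coe (f := f)]
    exact ⟨fun h k => k.casesOn i.2 h, fun h k => h (k + 1)⟩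
  rw [parentMatrix_mulVec K hx, Pi.zero_apply, sub_eq_zero]
  simp only [x, hstep]

end ParentMatrix

variable [Fintype V] [DecidableEq V] {K : Type*} [CommRing K]

/-- The Laplacian of a complete graph with weighted edges; the weights of loops cancel. -/
def weightedLaplacian (w : Sym2 V → K) : Matrix V V K :=
  Matrix.diagonal (fun i => ∑ v, w s(i, v)) - Matrix.of fun i j => w s(i, j)

variable (r) in
/-- The weighted Laplacian without the row and the column of `r`. -/
def reducedLaplacian (w : Sym2 V → K) : Matrix {i // i ≠ r} {i // i ≠ r} K :=
  (weightedLaplacian w).submatrix Subtype.val Subtype.val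

theorem reducedLaplacian_row (w : Sym2 V → K) (i : {i // i ≠ r}) :
    reducedLaplacian r w i =
      ∑ v, w s(i.1, v) • fun j : {i // i ≠ r} =>
        (if i = j then 1 else 0) - if v = j.1 then 1 else 0 := by
  ext j
  simp [reducedLaplacian, weightedLaplacian, Matrix.diagonal_apply, mul_sub, Subtype.ext_iff]

theorem det_reducedLaplacian_eq_sum_det_parentMatrix (w : Sym2 V → K) :
    (reducedLaplacian r w).det =
      ∑ f : {i // i ≠ r} → V, (∏ i : {i // i ≠ r}, w s(i.1, f i)) * (parentMatrix K f).det := by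
  rw [show reducedLaplacian r w = _ from funext (reducedLaplacian_row w)]
  change Matrix.detRowAlternating.toMultilinearMap _ = _
  rw [MultilinearMap.map_sum]
  refine Finset.sum_congr rfl fun f _ => ?_
  rw [MultilinearMap.map_smul_univ, smul_eq_mul]
  rfl

theorem IsRootedParent.prod_edgeSet_parentGraph {f : {i // i ≠ r} → V} (hf : IsRootedParent f)
    [Fintype (parentGraph f).edgeSet] (w : Sym2 V → K) :
    ∏ e ∈ (parentGraph f).edgeFinset, w e = ∏ i : {i // i ≠ r}, w s(i.1, f i) := by
  have himage : (parentGraph f).edgeFinset = Finset.univ.image fun i => s(i.1, f i) := by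
    ext e
    simp [hf.edgeSet_parentGraph]
  rw [himage, Finset.prod_image hf.edge_injective.injOn]

open Classical in
theorem det_reducedLaplacian_eq_sum_isTree (w : Sym2 V → K) :
    (reducedLaplacian r w).det = ∑ T : SimpleGraph V with T.IsTree, ∏ e ∈ T.edgeFinset, w e := by
  have hsupport (f : {i // i ≠ r} → V) (_ : f ∈ Finset.univ)
      (h : (∏ i : {i // i ≠ r}, w s(i.1, f i)) * (parentMatrix K f).det ≠ 0) :
      IsRootedParent f := by
    by_contra hf
    rw [det_parentMatrix_of_not_isRootedParent K hf, mul_zero] at h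
    exact h rfl
  rw [det_reducedLaplacian_eq_sum_det_parentMatrix, ← Finset.sum_filter_of_ne hsupport]
  refine Finset.sum_nbij parentGraph (fun f hf => ?_) (fun f hf g hg => ?_) (fun T hT => ?_)
    (fun f hf => ?_)
  all_goals simp only [Finset.coe_filter_univ, Set.mem_ofPred_eq, Finset.mem_filter_univ] at *
  · exact hf.isTree_parentGraph
  · exact hf.eq_of_parentGraph_eq hg
  · exact exists_parentGraph_eq_of_isTree r hT
  · rw [hf.det_parentMatrix K, mul_one, hf.prod_edgeSet_parentGraph]

end MatrixTree

section Laplacian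

section RowSums

variable {V K : Type*} [Fintype V] [AddCancelCommMonoid K] {A B : Matrix V V K}

theorem ext_of_forall_ne_of_sum_eq (hoff : ∀ i j, i ≠ j → A i j = B i j)
    (hsum : ∀ i, ∑ j, A i j = ∑ j, B i j) : A = B := by
  classical
  ext i j
  obtain rfl | hij := eq_or_ne i j
  · have h := hsum i
    rw [Fintype.sum_eq_add_sum_compl i, Fintype.sum_eq_add_sum_compl i,
      Finset.sum_congr rfl fun j hj => hoff i j (by simpa [eq_comm] using hj)] at h
    exact add_right_cancel h
  · exact hoff i j hij

theorem eq_of_isSymm_of_sum_eq {r : V} (hA : A.IsSymm) (hB : B.IsSymm)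
    (hsum : ∀ i, ∑ j, A i j = ∑ j, B i j) (h : ∀ i j, i ≠ r → j ≠ r → A i j = B i j) :
    A = B := by
  classical
  have hcol {i : V} (hi : i ≠ r) : A i r = B i r := by
    have hrow := hsum i
    rw [Fintype.sum_eq_add_sum_compl r, Fintype.sum_eq_add_sum_compl r,
      Finset.sum_congr rfl fun j hj => h i j hi (by simpa using hj)] at hrow
    exact add_right_cancel hrow
  refine ext_of_forall_ne_of_sum_eq (fun i j hij => ?_) hsum
  obtain rfl | hi := eq_or_ne i r
  · rw [← hA.apply, ← hB.apply, hcol hij.symm]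
  · obtain rfl | hj := eq_or_ne j r
    · exact hcol hi
    · exact h i j hi hj

end RowSums

variable {V K : Type*} [CommRing K]

open Classical in
/-- The weights on all pairs of vertices that are zero outside the edges of `G`. -/
noncomputable def extendWeights (G : SimpleGraph V) (x : G.edgeSet → K) (e : Sym2 V) : K :=
  if h : e ∈ G.edgeSet then x ⟨e, h⟩ else 0

theorem extendWeights_coe {G : SimpleGraph V} (x : G.edgeSet → K) (e : G.edgeSet) :
    extendWeights G x e = x e :=
  dif_pos e.2

theorem extendWeights_of_notMem {G : SimpleGraph V} (x : G.edgeSet → K) {e : Sym2 V}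
    (h : e ∉ G.edgeSet) : extendWeights G x e = 0 :=
  dif_neg h

section ZeroSumExtension

variable [DecidableEq V] (r : V)

/-- The matrix of the map `K^(V \ {r}) → K^V` sending the basis vector of `i` to that of `i` minus
that of `r`. -/
def rootDifference (K : Type*) [CommRing K] : Matrix V {i // i ≠ r} K :=
  Matrix.of fun i j => (1 : Matrix V V K) i j - (1 : Matrix V V K) i r

theorem rootDifference_submatrix :
    (rootDifference r K).submatrix (Subtype.val : {i // i ≠ r} → V) id = 1 := by
  ext i j
  simp [rootDifference, Matrix.one_apply, i.2, Subtype.ext_iff]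

end ZeroSumExtension

variable [Fintype V] [DecidableEq V]

theorem weightedLaplacian_apply_of_ne (w : Sym2 V → K) {i j : V} (h : i ≠ j) :
    weightedLaplacian w i j = -w s(i, j) := by
  rw [weightedLaplacian, Matrix.sub_apply, Matrix.diagonal_apply_ne _ h, zero_sub, Matrix.of_apply]

theorem isSymm_weightedLaplacian (w : Sym2 V → K) : (weightedLaplacian w).IsSymm :=
  .sub (Matrix.isSymm_diagonal _) <| Matrix.IsSymm.ext fun _ _ => congrArg w Sym2.eq_swap

theorem sum_weightedLaplacian (w : Sym2 V → K) (i : V) : ∑ j, weightedLaplacian w i j = 0 := by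
  simp [weightedLaplacian, Matrix.diagonal_apply]

variable (r : V)

/-- The extension of a matrix by a row and a column of index `r` such that all rows and columns sum
to zero; it inverts the passage from a Laplacian to the reduced Laplacian. -/
def zeroSumExtension (M : Matrix {i // i ≠ r} {i // i ≠ r} K) : Matrix V V K :=
  rootDifference r K * M * (rootDifference r K).transpose

variable {r}

theorem isSymm_zeroSumExtension {M : Matrix {i // i ≠ r} {i // i ≠ r} K} (hM : M.IsSymm) :
    (zeroSumExtension r M).IsSymm := by
  rw [Matrix.IsSymm, zeroSumExtension]
  simp only [Matrix.transpose_mul, Matrix.transpose_transpose, hM.eq, Matrix.mul_assoc]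

theorem zeroSumExtension_submatrix (M : Matrix {i // i ≠ r} {i // i ≠ r} K) :
    (zeroSumExtension r M).submatrix Subtype.val Subtype.val = M := by
  rw [zeroSumExtension, Matrix.submatrix_mul _ _ _ id _ Function.bijective_id,
    Matrix.submatrix_mul _ _ _ id _ Function.bijective_id, ← Matrix.transpose_submatrix,
    rootDifference_submatrix, Matrix.transpose_one, Matrix.mul_one, Matrix.submatrix_id_id,
    Matrix.one_mul]

theorem sum_rootDifference_col (j : {i // i ≠ r}) : ∑ i, rootDifference r K i j = 0 := by
  simp [rootDifference, Matrix.one_apply]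

theorem sum_zeroSumExtension (M : Matrix {i // i ≠ r} {i // i ≠ r} K) (i : V) :
    ∑ j, zeroSumExtension r M i j = 0 := by
  simp only [zeroSumExtension, Matrix.mul_apply, Matrix.transpose_apply (rootDifference r K)]
  rw [Finset.sum_comm]
  exact Finset.sum_eq_zero fun k _ => by rw [← Finset.mul_sum, sum_rootDifference_col, mul_zero]

theorem isSymmAvoiding_reducedLaplacian_extendWeights {G : SimpleGraph V} (x : G.edgeSet → K) :
    IsSymmAvoiding (Gᶜ.comap Subtype.val) (reducedLaplacian r (extendWeights G x)) where
  isSymm := (isSymm_weightedLaplacian _).submatrix _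
  apply_eq_zero i j hij := by
    rw [SimpleGraph.comap_adj, SimpleGraph.compl_adj] at hij
    rw [reducedLaplacian, Matrix.submatrix_apply, weightedLaplacian_apply_of_ne _ hij.1,
      extendWeights_of_notMem x hij.2, neg_zero]

theorem injective_weightedLaplacian_extendWeights (G : SimpleGraph V) :
    Function.Injective fun x : G.edgeSet → K => weightedLaplacian (extendWeights G x) := by
  rintro x y hxy
  ext ⟨e, he⟩
  induction e with | _ i j => ?_
  have hij : weightedLaplacian (extendWeights G x) i j =
      weightedLaplacian (extendWeights G y) i j := congr($hxy i j)
  have hne : i ≠ j := SimpleGraph.Adj.ne he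
  rw [weightedLaplacian_apply_of_ne _ hne, weightedLaplacian_apply_of_ne _ hne] at hij
  simpa only [extendWeights_coe x ⟨_, he⟩, extendWeights_coe y ⟨_, he⟩] using neg_injective hij

theorem exists_weightedLaplacian_extendWeights_eq {G : SimpleGraph V} {L : Matrix V V K}
    (hL : IsSymmAvoiding Gᶜ L) (hsum : ∀ i, ∑ j, L i j = 0) :
    ∃ x : G.edgeSet → K, weightedLaplacian (extendWeights G x) = L := by
  let w : Sym2 V → K := Sym2.lift ⟨fun i j => -L i j, fun i j =>
    congrArg Neg.neg (hL.isSymm.apply j i)⟩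
  refine ⟨fun e => w e, ext_of_forall_ne_of_sum_eq (fun i j hij => ?_) fun i => ?_⟩
  · rw [weightedLaplacian_apply_of_ne _ hij]
    by_cases hG : s(i, j) ∈ G.edgeSet
    · exact (congrArg Neg.neg (extendWeights_coe _ ⟨_, hG⟩)).trans (neg_neg (L i j))
    · rw [extendWeights_of_notMem _ hG, neg_zero, hL.apply_eq_zero ⟨hij, hG⟩]
  · rw [sum_weightedLaplacian, hsum]

theorem isSymmAvoiding_compl_zeroSumExtension {G : SimpleGraph V} (hr : G.IsUniversal r)
    {M : Matrix {i // i ≠ r} {i // i ≠ r} K} (hM : IsSymmAvoiding (Gᶜ.comap Subtype.val) M) :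
    IsSymmAvoiding Gᶜ (zeroSumExtension r M) := by
  refine ⟨isSymm_zeroSumExtension hM.isSymm, fun i j hij => ?_⟩
  have hi : i ≠ r := fun h => hij.2 (h ▸ hr (h ▸ hij.1))
  have hj : j ≠ r := fun h => hij.2 (h ▸ hr (h ▸ hij.1.symm)).symm
  exact congr($(zeroSumExtension_submatrix M) ⟨i, hi⟩ ⟨j, hj⟩).trans
    (hM.apply_eq_zero (i := ⟨i, hi⟩) (j := ⟨j, hj⟩) hij)

theorem bijective_reducedLaplacian_extendWeights {G : SimpleGraph V} (hr : G.IsUniversal r) :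
    Function.Bijective fun x : G.edgeSet → K =>
      (⟨reducedLaplacian r (extendWeights G x), isSymmAvoiding_reducedLaplacian_extendWeights x⟩ :
        {M // IsSymmAvoiding (Gᶜ.comap (Subtype.val : {i // i ≠ r} → V)) M}) := by
  refine ⟨fun x y hxy => injective_weightedLaplacian_extendWeights G ?_, fun ⟨M, hM⟩ => ?_⟩
  · refine eq_of_isSymm_of_sum_eq (r := r) (isSymm_weightedLaplacian _)
      (isSymm_weightedLaplacian _) (fun i => ?_) fun i j hi hj => ?_
    · rw [sum_weightedLaplacian, sum_weightedLaplacian]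
    · exact congr($(congrArg Subtype.val hxy) ⟨i, hi⟩ ⟨j, hj⟩)
  · obtain ⟨x, hx⟩ := exists_weightedLaplacian_extendWeights_eq
      (isSymmAvoiding_compl_zeroSumExtension hr hM) (sum_zeroSumExtension M)
    refine ⟨x, Subtype.ext ?_⟩
    change (weightedLaplacian _).submatrix _ _ = M
    rw [hx, zeroSumExtension_submatrix]

end Laplacian

section Points

theorem rank_eq_card_iff_isUnit_det {n K : Type*} [Fintype n] [DecidableEq n] [Field K]
    {M : Matrix n n K} : M.rank = Fintype.card n ↔ IsUnit M.det := by
  rw [← Matrix.isUnit_iff_isUnit_det, ← Matrix.linearIndependent_cols_iff_isUnit,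
    linearIndependent_iff_card_eq_finrank_span, Matrix.rank_eq_finrank_span_cols, eq_comm]
  rfl

/-- The points of the spectrum of a localization `R[1/a]` are the ring homomorphisms from `R` that
invert `a`. -/
noncomputable def specAwayPointsEquiv {R : Type} [CommRing R] (a : R) (K : Type) [CommRing K] :
    (Spec (CommRingCat.of K) ⟶ Spec (CommRingCat.of (Localization.Away a))) ≃
      {φ : R →+* K // IsUnit (φ a)} :=
  (Spec.homEquiv.trans ConcreteCategory.homEquiv).trans
    { toFun := fun φ => ⟨φ.comp (algebraMap R (Localization.Away a)),
        (IsLocalization.Away.algebraMap_isUnit a).map φ⟩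
      invFun := fun φ => IsLocalization.Away.lift a φ.2
      left_inv := fun _ => IsLocalization.ringHom_ext (Submonoid.powers a)
        (IsLocalization.Away.lift_comp a _)
      right_inv := fun _ => Subtype.ext (IsLocalization.Away.lift_comp a _) }

theorem homEquiv_symm_X {σ K : Type*} [CommRing K] (x : σ → K) (i : σ) :
    MvPolynomial.homEquiv.symm x (MvPolynomial.X i) = x i :=
  congrFun (MvPolynomial.homEquiv.apply_symm_apply x) i

variable {V : Type}

theorem symmetricSupportIdeal_le_ker_iff {K : Type*} [CommRing K] {G : SimpleGraph V}
    {φ : MvPolynomial (V × V) ℤ →+* K} :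
    symmetricSupportIdeal G ≤ RingHom.ker φ ↔
      IsSymmAvoiding Gᶜ (Matrix.of fun i j => φ (MvPolynomial.X (i, j))) := by
  rw [symmetricSupportIdeal, Ideal.span_le]
  refine ⟨fun h => ⟨Matrix.IsSymm.ext fun i j => ?_, fun i j hij => ?_⟩, ?_⟩
  · exact RingHom.sub_mem_ker_iff φ |>.mp (h (.inl ⟨j, i, rfl⟩))
  · exact h (.inr ⟨i, j, hij.1, hij.2, rfl⟩)
  · rintro h _ (⟨i, j, rfl⟩ | ⟨i, j, hij, hG, rfl⟩)
    · exact (RingHom.sub_mem_ker_iff φ).mpr (h.isSymm.apply j i)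
    · exact h.apply_eq_zero ⟨hij, hG⟩

/-- The universal property of the generic symmetric matrix: ring homomorphisms from its coefficient
ring are its specializations. -/
noncomputable def genericSymmetricMatrixHomEquiv (G : SimpleGraph V) (K : Type*) [CommRing K] :
    (MvPolynomial (V × V) ℤ ⧸ symmetricSupportIdeal G →+* K) ≃
      {M : Matrix V V K // IsSymmAvoiding Gᶜ M} where
  toFun φ := ⟨(genericSymmetricMatrix G).map φ, symmetricSupportIdeal_le_ker_iff
    (φ := φ.comp (Ideal.Quotient.mk _)).mp fun _ hp =>
      (congrArg φ (Ideal.Quotient.eq_zero_iff_mem.mpr hp)).trans (map_zero φ)⟩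
  invFun M := Ideal.Quotient.lift _ (MvPolynomial.homEquiv.symm fun p => M.1 p.1 p.2)
    (symmetricSupportIdeal_le_ker_iff.mpr (by
      simp only [homEquiv_symm_X]
      exact M.2))
  left_inv φ := Ideal.Quotient.ringHom_ext (MvPolynomial.homEquiv.symm_apply_apply
    (φ.comp (Ideal.Quotient.mk _)))
  right_inv M := Subtype.ext (Matrix.ext fun i j => homEquiv_symm_X _ (i, j))

variable [Fintype V]

open Classical in
theorem prod_edgeFinset_extendWeights {K : Type*} [CommRing K] {G T : SimpleGraph V} (hTG : T ≤ G)
    (x : G.edgeSet → K) :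
    ∏ e ∈ T.edgeFinset, extendWeights G x e =
      ∏ e ∈ Finset.univ.filter fun e : G.edgeSet => (e : Sym2 V) ∈ T.edgeSet, x e := by
  symm
  refine Finset.prod_nbij Subtype.val (fun e he => ?_) Subtype.val_injective.injOn (fun e he => ?_)
    fun e _ => (extendWeights_coe x e).symm
  · simpa using he
  · have heT : e ∈ T.edgeSet := by simpa using he
    exact ⟨⟨e, SimpleGraph.edgeSet_mono hTG heT⟩, by simpa using heT, rfl⟩

variable [DecidableEq V]

/-- The points of `Z^o_G`: the invertible symmetric matrices that vanish at the non-edges of `G`. -/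
noncomputable def nondegSymmetricPointsEquiv (G : SimpleGraph V) (K : Type) [CommRing K] :
    (Spec (CommRingCat.of K) ⟶ nondegSymmetricScheme G) ≃
      {M : Matrix V V K // IsSymmAvoiding Gᶜ M ∧ IsUnit M.det} :=
  (specAwayPointsEquiv (genericSymmetricMatrix G).det K).trans <|
    ((genericSymmetricMatrixHomEquiv G K).subtypeEquiv (q := fun M => IsUnit M.1.det) fun φ => by
      rw [RingHom.map_det]
      rfl).trans
    (Equiv.subtypeSubtypeEquivSubtypeInter _ fun M : Matrix V V K => IsUnit M.det)

theorem aeval_stanleyPolynomial {K : Type*} [CommRing K] (G : SimpleGraph V) (r : V)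
    (x : G.edgeSet → K) :
    MvPolynomial.aeval x (stanleyPolynomial G) = (reducedLaplacian r (extendWeights G x)).det := by
  classical
  have hle (T : SimpleGraph V) (_ : T ∈ Finset.univ.filter SimpleGraph.IsTree)
      (h : ∏ e ∈ T.edgeFinset, extendWeights G x e ≠ 0) : T ≤ G := by
    rw [← SimpleGraph.edgeSet_subset_edgeSet]
    intro e he
    by_contra heG
    exact h <| Finset.prod_eq_zero (SimpleGraph.mem_edgeFinset.mpr he) <|
      extendWeights_of_notMem x heG
  rw [det_reducedLaplacian_eq_sum_isTree, ← Finset.sum_filter_of_ne hle, Finset.filter_filter,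
    stanleyPolynomial, map_sum]
  refine Finset.sum_congr (by ext T; simp only [Finset.mem_filter_univ, and_comm]) fun T hT => ?_
  rw [prod_edgeFinset_extendWeights (Finset.mem_filter.mp hT).2.2, map_prod]
  exact Finset.prod_congr rfl fun e _ => MvPolynomial.aeval_X x e

/-- The points of `X_G` when `r` is joined to all other vertices: by the matrix-tree theorem, a
choice of edge weights corresponds to its reduced Laplacian. -/
noncomputable def stanleyPointsEquiv {G : SimpleGraph V} {r : V} (hr : G.IsUniversal r) (K : Type)
    [CommRing K] :
    (Spec (CommRingCat.of K) ⟶ stanleyScheme G) ≃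
      {M : Matrix {i // i ≠ r} {i // i ≠ r} K //
        IsSymmAvoiding (Gᶜ.comap Subtype.val) M ∧ IsUnit M.det} :=
  (specAwayPointsEquiv (stanleyPolynomial G) K).trans <|
    ((MvPolynomial.homEquiv.trans
      (.ofBijective _ (bijective_reducedLaplacian_extendWeights hr))).subtypeEquiv
        (q := fun M => IsUnit M.1.det) fun φ => by
          obtain ⟨x, rfl⟩ := MvPolynomial.homEquiv.symm.surjective φ
          rw [Equiv.trans_apply, Equiv.apply_symm_apply]
          exact congrArg IsUnit (aeval_stanleyPolynomial G r x) |>.to_iff).trans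
    (Equiv.subtypeSubtypeEquivSubtypeInter _ fun M : Matrix _ _ K => IsUnit M.det)

end Points

section PolynomialCount

variable {V : Type*} [Fintype V] [DecidableEq V]

open Classical in
theorem rankSum_ite_card {K R : Type*} [Field K] [Fintype K] [CommRing R] (H : SimpleGraph V) :
    rankSum K H (fun σ => if σ = Fintype.card V then (1 : R) else 0) =
      Nat.card {M : Matrix V V K // IsSymmAvoiding H M ∧ IsUnit M.det} := by
  rw [rankSum, Finset.sum_boole, Nat.card_eq_fintype_card, Fintype.card_subtype]
  congr 2
  ext M
  simp only [Finset.mem_filter, mem_symmAvoidingMatrices, rank_eq_card_iff_isUnit_det,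
    Finset.mem_univ, true_and]

theorem polynomiallyCountable_of_equiv {X : Scheme.{0}} {H : SimpleGraph V} (hH : H.IsAcyclic)
    (e : ∀ (K : Type) [Field K],
      (Spec (CommRingCat.of K) ⟶ X) ≃ {M : Matrix V V K // IsSymmAvoiding H M ∧ IsUnit M.det}) :
    PolynomiallyCountable X := by
  obtain ⟨P, hP⟩ := isPolynomialRankSum_of_isAcyclic hH fun σ => if σ = Fintype.card V then 1 else 0
  refine ⟨P, fun K _ _ => ⟨.of_equiv _ (e K).symm, ?_⟩⟩
  have := Fintype.ofFinite K
  rw [Nat.card_congr (e K), ← rankSum_ite_card (R := ℤ) H, Nat.card_eq_fintype_card, ← hP K]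
  congr 1
  ext σ
  split_ifs <;> simp

end PolynomialCount

section Graph

variable {V : Type*}

theorem isAcyclic_spanningCoe {s : Set V} {G : SimpleGraph s} (hG : G.IsAcyclic) :
    G.spanningCoe.IsAcyclic := fun v c hc => by
  have hs (u : V) (hu : u ∈ c.support) : u ∈ s := by
    obtain ⟨u, -, rfl⟩ := (SimpleGraph.support_spanningCoe G).subset
      (SimpleGraph.mem_support_of_mem_walk_support c hc.not_nil hu)
    exact u.2
  rw [← SimpleGraph.induce_spanningCoe (G := G)] at hG
  refine hG (c.induce s hs) (.of_map (f := (SimpleGraph.Embedding.induce s).toHom) ?_)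
  rwa [SimpleGraph.Walk.map_induce]

variable {F : (⊤ : SimpleGraph V).Subgraph}

theorem isAcyclic_compl_deleteEdges_edgeSet (hF : F.coe.IsAcyclic) :
    ((⊤ : SimpleGraph V).deleteEdges F.edgeSet)ᶜ.IsAcyclic := by
  have hcompl : ((⊤ : SimpleGraph V).deleteEdges F.edgeSet)ᶜ = F.spanningCoe := by
    ext i j
    simp only [SimpleGraph.compl_adj, SimpleGraph.deleteEdges_adj, SimpleGraph.top_adj,
      SimpleGraph.Subgraph.mem_edgeSet, SimpleGraph.Subgraph.spanningCoe_adj]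
    exact ⟨fun h => by_contra fun hF => h.2 ⟨h.1, hF⟩, fun h => ⟨h.ne, fun h' => h'.2 h⟩⟩
  rw [hcompl, ← SimpleGraph.Subgraph.spanningCoe_coe]
  exact isAcyclic_spanningCoe hF

theorem exists_isUniversal_deleteEdges_edgeSet (hF : F.verts.ncard < Nat.card V) :
    ∃ v, ((⊤ : SimpleGraph V).deleteEdges F.edgeSet).IsUniversal v := by
  obtain ⟨v, hv⟩ := (Set.ne_univ_iff_exists_notMem F.verts).mp fun h => by
    rw [h, Set.ncard_univ] at hF
    exact lt_irrefl _ hF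
  exact ⟨v, fun _ hvw => SimpleGraph.deleteEdges_adj.mpr ⟨hvw, fun h => hv (F.edge_vert h)⟩⟩

end Graph

theorem mainTheorem9_general {V : Type} [Fintype V] [DecidableEq V] (G : SimpleGraph V)
    (hG : Gᶜ.IsAcyclic) :
    PolynomiallyCountable (nondegSymmetricScheme G) ∧
      ((∃ v, G.IsUniversal v) → PolynomiallyCountable (stanleyScheme G)) :=
  ⟨polynomiallyCountable_of_equiv hG fun K _ => nondegSymmetricPointsEquiv G K, fun ⟨_, hv⟩ =>
    polynomiallyCountable_of_equiv (hG.of_comap (.subtype _)) fun K _ => stanleyPointsEquiv hv K⟩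

theorem mainTheorem9 (s r : ℕ) (F : (⊤ : SimpleGraph (Fin s)).Subgraph)
    (hF : F.coe.IsAcyclic) (hr : F.verts.ncard = r) :
    PolynomiallyCountable
        (nondegSymmetricScheme ((⊤ : SimpleGraph (Fin s)).deleteEdges F.edgeSet)) ∧
      (s > r →
        PolynomiallyCountable
          (stanleyScheme ((⊤ : SimpleGraph (Fin s)).deleteEdges F.edgeSet))) := by
  obtain ⟨hZ, hX⟩ := mainTheorem9_general _ (isAcyclic_compl_deleteEdges_edgeSet hF)
  exact ⟨hZ, fun hsr => hX (exists_isUniversal_deleteEdges_edgeSet (by rwa [hr, Nat.card_fin]))⟩
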